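/- Let $B_n(t)\in\mathbb{Z}[t]$ be the Stern polynomials, defined by $B_0(t)=0$, $B_1(t)=1$ and, for $n\ge 2$, $B_n(t)=t\,B_{n/2}(t)$ if $n$ is even and $B_n(t)=B_{(n-1)/2}(t)+B_{(n+1)/2}(t)$ if $n$ is odd. Let $e(n)=\deg B_n(t)$ for $n\ge 1$, and let $\mathcal{E}_1(x)=\sum_{n=1}^{\infty}e(n)x^n\in\mathbb{Z}[[x]]$. For a commutative ring $R$, a power series $f(x)=\sum_{n\ge 0}u(n)x^n\in R[[x]]$ is called $k$-regular if the $R$-module generated by all sequences $(u(k^jn+r))_{n\ge 0}$ with $j\ge 0$ and $0\le r<k^j$ is finitely generated. Then $\mathcal{E}_1(x)$ is a $2$-regular power series, both over $R=\mathbb{Z}$ and (viewed in $\mathbb{Q}[[x]]$) over $R=\mathbb{Q}$, and it is transcendental over the field $\mathbb{Q}(x)$ of rational functions (as an element of the field $\mathbb{Q}((x))$ of formal Laurent series). -/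

import Mathlib

namespace SternDegree

open Polynomial

/-- The Stern polynomials `B_n(t) ∈ ℤ[t]`: `B_0 = 0`, `B_1 = 1`, and for `n ≥ 2`
`B_n = t B_{n/2}` if `n` is even, `B_n = B_{(n-1)/2} + B_{(n+1)/2}` if `n` is odd. -/
noncomputable def sternPoly : ℕ → ℤ[X]
  | 0 => 0
  | 1 => 1
  | n + 2 =>
    if (n + 2) % 2 = 0 then X * sternPoly ((n + 2) / 2)
    else sternPoly ((n + 2 - 1) / 2) + sternPoly ((n + 2 + 1) / 2)
termination_by n => n
decreasing_by all_goals omega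

/-- `e(n) = deg B_n(t)`, used only for `n ≥ 1`. -/
noncomputable def e (n : ℕ) : ℕ := (sternPoly n).natDegree

/-- The ordinary generating function `∑_{n ≥ 1} e(n) x^n ∈ ℤ⟦x⟧`. -/
noncomputable def genE : PowerSeries ℤ :=
  PowerSeries.mk fun n => if n = 0 then 0 else (e n : ℤ)

/-- The `k`-kernel of a sequence `u`: the set of its subsequences `n ↦ u (k ^ j * n + r)`
with `j ≥ 0` and `0 ≤ r < k ^ j`. -/
def kKernel {R : Type*} (k : ℕ) (u : ℕ → R) : Set (ℕ → R) :=
  {v | ∃ j r : ℕ, r < k ^ j ∧ v = fun n => u (k ^ j * n + r)}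

/-- A power series over `R` is `k`-regular (over `R`) if the `k`-kernel of its sequence of
coefficients generates a finitely generated `R`-module. -/
def IsKRegular {R : Type*} [CommRing R] (k : ℕ) (f : PowerSeries R) : Prop :=
  (Submodule.span R (kKernel k fun n => PowerSeries.coeff n f)).FG

end SternDegree

-- activates the canonical embedding of `ℚ(x)` into `ℚ((x))` as an algebra structure
open scoped RatFunc

namespace SternDegree

open Polynomial

/-! Nonnegative coefficients exclude cancellation, so `e (2n+1)` is a maximum of neighbouring
values. Neighbours differ by at most 1 (`e_adjacent`), which settles that maximum modulo 4:
`e_four_mul_add_one` and `e_four_mul_add_three`. Five sequences then span a bisection-stable module,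
whence regularity over any noetherian ring.

For transcendence, `e n` tends to infinity but is at most log₂ n. So the Abel mean (1 - x)∑ e(n)xⁿ
tends to infinity along points x → 1⁻, more slowly than any power of 1/(1 - x). In a primitive
algebraic relation over ℚ[X], the coefficients may then be replaced by their values at 1 with error
o(1). This leaves a nonzero real polynomial tending to 0 along arguments tending to infinity, which
is impossible (`eval₂_ne_zero_of_slow_growth`). -/

/-! ### Recurrences and growth of the degrees. -/

theorem sternPoly_zero : sternPoly 0 = 0 := by rw [sternPoly]

theorem sternPoly_one : sternPoly 1 = 1 := by rw [sternPoly]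

theorem sternPoly_two_mul (n : ℕ) : sternPoly (2 * n) = X * sternPoly n := by
  rcases n with _ | n
  · simp [sternPoly_zero]
  · rw [show 2 * (n + 1) = 2 * n + 2 by ring, sternPoly, if_pos (by omega)]
    congr 2
    omega

theorem sternPoly_two_mul_add_one (n : ℕ) :
    sternPoly (2 * n + 1) = sternPoly n + sternPoly (n + 1) := by
  rcases n with _ | n
  · simp [sternPoly_zero, sternPoly_one]
  · rw [show 2 * (n + 1) + 1 = (2 * n + 1) + 2 by ring, sternPoly, if_neg (by omega)]
    congr 2 <;> omega

theorem coeff_sternPoly_nonneg (n i : ℕ) : 0 ≤ (sternPoly n).coeff i := by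
  induction n using Nat.strong_induction_on generalizing i with
  | _ n ih =>
    rcases Nat.even_or_odd' n with ⟨m, rfl | rfl⟩
    · rcases m with _ | m
      · simp [sternPoly_zero]
      · rw [sternPoly_two_mul]
        rcases i with _ | i
        · simp
        · rw [coeff_X_mul]
          exact ih _ (by omega) _
    · rcases m with _ | m
      · rw [mul_zero, zero_add, sternPoly_one, coeff_one]
        split_ifs <;> simp
      · rw [sternPoly_two_mul_add_one, coeff_add]
        exact add_nonneg (ih _ (by omega) _) (ih _ (by omega) _)

theorem natDegree_add_of_coeff_nonneg {p q : ℤ[X]} (hp : ∀ i, 0 ≤ p.coeff i)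
    (hq : ∀ i, 0 ≤ q.coeff i) : (p + q).natDegree = max p.natDegree q.natDegree := by
  have key : ∀ {p q : ℤ[X]}, (∀ i, 0 ≤ p.coeff i) → (∀ i, 0 ≤ q.coeff i) →
      p.natDegree ≤ (p + q).natDegree := by
    intro p q hp hq
    rcases eq_or_ne p 0 with rfl | h
    · simp
    · refine le_natDegree_of_ne_zero ?_
      have h1 : p.coeff p.natDegree ≠ 0 := by simpa using h
      have h2 := hp p.natDegree
      have h3 := hq p.natDegree
      rw [coeff_add]
      omega
  refine le_antisymm (natDegree_add_le p q) (max_le (key hp hq) ?_)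
  rw [add_comm]
  exact key hq hp

theorem sternPoly_ne_zero {n : ℕ} (hn : n ≠ 0) : sternPoly n ≠ 0 := by
  induction n using Nat.strong_induction_on with
  | _ n ih =>
    rcases Nat.even_or_odd' n with ⟨m, rfl | rfl⟩
    · rw [sternPoly_two_mul]
      exact mul_ne_zero X_ne_zero (ih m (by omega) (by omega))
    · rcases m with _ | m
      · simp [sternPoly_one]
      · intro h
        refine ih (m + 1) (by omega) (by omega) (Polynomial.ext fun i => ?_)
        have h1 := coeff_sternPoly_nonneg (m + 1) i
        have h2 := coeff_sternPoly_nonneg (m + 1 + 1) i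
        have h3 := congrArg (fun p => coeff p i) h
        simp only [sternPoly_two_mul_add_one, coeff_add, coeff_zero] at h3 ⊢
        omega

theorem e_zero : e 0 = 0 := by simp [e, sternPoly_zero]

theorem e_one : e 1 = 0 := by simp [e, sternPoly_one]

theorem e_two_mul {n : ℕ} (hn : n ≠ 0) : e (2 * n) = e n + 1 := by
  rw [e, sternPoly_two_mul, natDegree_X_mul (sternPoly_ne_zero hn), e]

theorem e_two_mul_add_one (n : ℕ) : e (2 * n + 1) = max (e n) (e (n + 1)) := by
  rw [e, sternPoly_two_mul_add_one,
    natDegree_add_of_coeff_nonneg (coeff_sternPoly_nonneg _) (coeff_sternPoly_nonneg _), e, e]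

theorem e_adjacent (n : ℕ) : e (n + 1) ≤ e n + 1 ∧ e n ≤ e (n + 1) + 1 := by
  induction n using Nat.strong_induction_on with
  | _ n ih =>
    rcases Nat.even_or_odd' n with ⟨m, rfl | rfl⟩
    · rcases eq_or_ne m 0 with rfl | hm
      · simp [e_zero, e_one]
      · have := ih m (by omega)
        rw [e_two_mul_add_one, e_two_mul hm]
        omega
    · have := ih m (by omega)
      rw [e_two_mul_add_one, show 2 * m + 1 + 1 = 2 * (m + 1) by ring, e_two_mul (by omega)]
      omega

theorem e_four_mul_add_one {n : ℕ} (hn : n ≠ 0) : e (4 * n + 1) = e n + 1 := by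
  have := e_adjacent n
  rw [show 4 * n + 1 = 2 * (2 * n) + 1 by ring, e_two_mul_add_one, e_two_mul hn,
    e_two_mul_add_one]
  omega

theorem e_four_mul_add_three (n : ℕ) : e (4 * n + 3) = e (n + 1) + 1 := by
  have := e_adjacent n
  rw [show 4 * n + 3 = 2 * (2 * n + 1) + 1 by ring, e_two_mul_add_one, e_two_mul_add_one,
    show 2 * n + 1 + 1 = 2 * (n + 1) by ring, e_two_mul (by omega)]
  omega

/-- Each reduction lowers the degree by one and the index by a factor of about four at most. -/
theorem le_e_of_four_pow_le {m n : ℕ} (h : 4 ^ m ≤ n) : m ≤ e n := by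
  induction m generalizing n with
  | zero => omega
  | succ m ih =>
    have h0 : 0 < 4 ^ m := by positivity
    rw [pow_succ] at h
    obtain ⟨k, hk | hk | hk⟩ : ∃ k, n = 2 * k ∨ n = 4 * k + 1 ∨ n = 4 * k + 3 := by
      rcases (by omega : n % 2 = 0 ∨ n % 4 = 1 ∨ n % 4 = 3) with h | h | h
      exacts [⟨n / 2, by omega⟩, ⟨n / 4, by omega⟩, ⟨n / 4, by omega⟩]
    · rw [hk, e_two_mul (by omega)]
      exact Nat.succ_le_succ (ih (by omega))
    · rw [hk, e_four_mul_add_one (by omega)]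
      exact Nat.succ_le_succ (ih (by omega))
    · rw [hk, e_four_mul_add_three]
      exact Nat.succ_le_succ (ih (by omega))

theorem two_pow_e_le {n : ℕ} (hn : n ≠ 0) : 2 ^ e n ≤ n := by
  induction n using Nat.strong_induction_on with
  | _ n ih =>
    rcases eq_or_ne n 1 with rfl | h1
    · simp [e_one]
    obtain ⟨k, hk | hk | hk⟩ : ∃ k, n = 2 * k ∨ n = 4 * k + 1 ∨ n = 4 * k + 3 := by
      rcases (by omega : n % 2 = 0 ∨ n % 4 = 1 ∨ n % 4 = 3) with h | h | h
      exacts [⟨n / 2, by omega⟩, ⟨n / 4, by omega⟩, ⟨n / 4, by omega⟩]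
    · have := ih k (by omega) (by omega)
      rw [hk, e_two_mul (by omega), pow_succ]
      omega
    · have := ih k (by omega) (by omega)
      rw [hk, e_four_mul_add_one (by omega), pow_succ]
      omega
    · have := ih (k + 1) (by omega) (by omega)
      rw [hk, e_four_mul_add_three, pow_succ]
      omega

/-- A family of linear majorants standing in for log₂ n: they sum in closed form, and `K` can be
tuned to the evaluation point. -/
theorem e_le_add_div (K n : ℕ) : (e n : ℝ) ≤ K + n / 2 ^ K := by
  rcases le_or_gt (e n) K with h | h
  · have : (e n : ℝ) ≤ K := by exact_mod_cast h
    have : (0 : ℝ) ≤ n / 2 ^ K := by positivity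
    linarith
  · obtain ⟨j, hj⟩ := Nat.exists_eq_add_of_lt h
    have hn : n ≠ 0 := by
      rintro rfl
      simp [e_zero] at h
    have h1 : (2 : ℝ) ^ e n ≤ n := by exact_mod_cast two_pow_e_le hn
    have h2 : ((j + 1 : ℕ) : ℝ) ≤ 2 ^ (j + 1) := by exact_mod_cast Nat.lt_two_pow_self.le
    rw [show e n = K + (j + 1) by omega] at h1 ⊢
    have h3 : (2 : ℝ) ^ (j + 1) ≤ n / 2 ^ K := by
      rw [le_div_iff₀ (by positivity), ← pow_add, add_comm]
      exact h1
    push_cast at h2 ⊢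
    linarith

theorem coeff_genE (n : ℕ) : PowerSeries.coeff n genE = (e n : ℤ) := by
  rw [genE, PowerSeries.coeff_mk]
  split_ifs with h
  · simp [h, e_zero]
  · rfl

/-! ### Regularity. -/

/-- If a finitely generated module over a noetherian ring contains `u` and is stable under the
two bisection maps, the module generated by the `2`-kernel of `u` is finitely generated. -/
theorem span_kKernel_two_fg {R : Type*} [CommRing R] [IsNoetherianRing R] {u : ℕ → R}
    {M : Submodule R (ℕ → R)} (hM : M.FG) (hu : u ∈ M)
    (h0 : ∀ v ∈ M, (fun n => v (2 * n)) ∈ M) (h1 : ∀ v ∈ M, (fun n => v (2 * n + 1)) ∈ M) :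
    (Submodule.span R (kKernel 2 u)).FG := by
  have key : ∀ j r, ∀ v ∈ M, r < 2 ^ j → (fun n => v (2 ^ j * n + r)) ∈ M := by
    intro j
    induction j with
    | zero =>
      intro r v hv hr
      obtain rfl : r = 0 := by simpa using hr
      simpa using hv
    | succ j ih =>
      intro r v hv hr
      rw [pow_succ] at hr
      rcases Nat.even_or_odd' r with ⟨s, rfl | rfl⟩
      · convert ih s _ (h0 v hv) (by omega) using 3
        ring
      · convert ih s _ (h1 v hv) (by omega) using 3
        ring
  have hle : Submodule.span R (kKernel 2 u) ≤ M := by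
    refine Submodule.span_le.2 ?_
    rintro v ⟨j, r, hr, rfl⟩
    exact key j r u hu hr
  have : IsNoetherian R M := isNoetherian_of_fg_of_noetherian M hM
  exact isNoetherian_submodule.1 this _ hle

/-- The generators of a bisection-stable module containing `e`. -/
def kernelGenerators (R : Type*) [CommRing R] : Set (ℕ → R) :=
  {fun n => (e n : R), fun n => (e (n + 1) : R), fun n => (e (2 * n + 1) : R), fun _ => 1,
    fun n => if n = 0 then 1 else 0}

theorem span_kKernel_two_e_fg (R : Type*) [CommRing R] [IsNoetherianRing R] :
    (Submodule.span R (kKernel 2 fun n => (e n : R))).FG := by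
  set M := Submodule.span R (kernelGenerators R) with hM
  have ha : (fun n => (e n : R)) ∈ M := Submodule.subset_span (by simp [kernelGenerators])
  have hb : (fun n => (e (n + 1) : R)) ∈ M := Submodule.subset_span (by simp [kernelGenerators])
  have hc : (fun n => (e (2 * n + 1) : R)) ∈ M :=
    Submodule.subset_span (by simp [kernelGenerators])
  have hd : (fun _ => 1 : ℕ → R) ∈ M := Submodule.subset_span (by simp [kernelGenerators])
  have hf : (fun n => if n = 0 then 1 else 0 : ℕ → R) ∈ M :=
    Submodule.subset_span (by simp [kernelGenerators])
  -- The indicator of 0 absorbs the failure at n = 0 of the recurrences for `2 * n` and `4 * n + 1`.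
  have ha' : (fun n => (if n = 0 then 0 else e n + 1 : R)) ∈ M := by
    convert M.sub_mem (M.add_mem ha hd) hf using 1
    funext n
    rcases eq_or_ne n 0 with rfl | hn
    · simp [e_zero]
    · simp [hn]
  have hb' : (fun n => (e (n + 1) + 1 : R)) ∈ M := M.add_mem hb hd
  have stable : ∀ b : ℕ, (∀ v ∈ kernelGenerators R, (fun n => v (2 * n + b)) ∈ M) →
      ∀ v ∈ M, (fun n => v (2 * n + b)) ∈ M := by
    intro b hgen v hv
    have : M ≤ M.comap (LinearMap.funLeft R R fun n => 2 * n + b) :=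
      Submodule.span_le.2 hgen
    exact this hv
  refine span_kKernel_two_fg (M := M) (Submodule.fg_span (by simp [kernelGenerators])) ha
    (stable 0 ?_) (stable 1 ?_)
  · rintro v (rfl | rfl | rfl | rfl | rfl)
    · convert ha' using 1
      funext n
      rcases eq_or_ne n 0 with rfl | hn
      · simp [e_zero]
      · simp [hn, e_two_mul hn]
    · exact hc
    · convert ha' using 1
      funext n
      rcases eq_or_ne n 0 with rfl | hn
      · simp [e_one]
      · simp only [hn, if_false]
        rw [show 2 * (2 * n + 0) + 1 = 4 * n + 1 by ring, e_four_mul_add_one hn]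
        push_cast
        rfl
    · exact hd
    · convert hf using 1
      funext n
      simp
  · rintro v (rfl | rfl | rfl | rfl | rfl)
    · exact hc
    · convert hb' using 1
      funext n
      beta_reduce
      rw [show 2 * n + 1 + 1 = 2 * (n + 1) by ring, e_two_mul (by omega)]
      push_cast
      rfl
    · convert hb' using 1
      funext n
      beta_reduce
      rw [show 2 * (2 * n + 1) + 1 = 4 * n + 3 by ring, e_four_mul_add_three]
      push_cast
      rfl
    · exact hd
    · convert M.zero_mem using 1
      funext n
      simp

theorem isKRegular_map_genE {R : Type*} [CommRing R] [IsNoetherianRing R] (φ : ℤ →+* R) :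
    IsKRegular 2 (PowerSeries.map φ genE) := by
  have h : (fun n => PowerSeries.coeff n (PowerSeries.map φ genE)) = fun n => (e n : R) := by
    funext n
    rw [PowerSeries.coeff_map, coeff_genE, map_natCast]
  rw [IsKRegular, h]
  exact span_kKernel_two_e_fg R

/-! ### Evaluating power series at real points. -/

open Filter Topology

/-- The power series `f` converges absolutely at the real number `x`, with sum `y`. -/
def HasAbsSumAt (x : ℝ) (f : PowerSeries ℚ) (y : ℝ) : Prop :=
  (Summable fun n => ‖((PowerSeries.coeff n f : ℚ) : ℝ) * x ^ n‖) ∧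
    HasSum (fun n => ((PowerSeries.coeff n f : ℚ) : ℝ) * x ^ n) y

namespace HasAbsSumAt

variable {x y z : ℝ} {f g : PowerSeries ℚ}

theorem unique (hf : HasAbsSumAt x f y) (hg : HasAbsSumAt x f z) : y = z :=
  hf.2.unique hg.2

theorem add (hf : HasAbsSumAt x f y) (hg : HasAbsSumAt x g z) :
    HasAbsSumAt x (f + g) (y + z) := by
  refine ⟨(hf.1.add hg.1).of_nonneg_of_le (fun _ => norm_nonneg _) fun n => ?_, ?_⟩
  · rw [map_add, Rat.cast_add, add_mul]
    exact norm_add_le _ _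
  · simpa only [map_add, Rat.cast_add, add_mul] using hf.2.add hg.2

theorem mul (hf : HasAbsSumAt x f y) (hg : HasAbsSumAt x g z) :
    HasAbsSumAt x (f * g) (y * z) := by
  have h : ∀ n, ((PowerSeries.coeff n (f * g) : ℚ) : ℝ) * x ^ n =
      ∑ kl ∈ Finset.HasAntidiagonal.antidiagonal n, ((PowerSeries.coeff kl.1 f : ℚ) : ℝ) * x ^ kl.1 *
        (((PowerSeries.coeff kl.2 g : ℚ) : ℝ) * x ^ kl.2) := by
    intro n
    rw [PowerSeries.coeff_mul, Rat.cast_sum, Finset.sum_mul]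
    refine Finset.sum_congr rfl fun kl hkl => ?_
    rw [← Finset.HasAntidiagonal.mem_antidiagonal.1 hkl, pow_add, Rat.cast_mul]
    ring
  have hs := summable_norm_sum_mul_antidiagonal_of_summable_norm hf.1 hg.1
  simp only [HasAbsSumAt, h]
  refine ⟨hs, ?_⟩
  rw [← hf.2.tsum_eq, ← hg.2.tsum_eq,
    tsum_mul_tsum_eq_tsum_sum_antidiagonal_of_summable_norm hf.1 hg.1]
  exact hs.of_norm.hasSum

theorem coe_polynomial (x : ℝ) (p : ℚ[X]) : HasAbsSumAt x (p : PowerSeries ℚ) (aeval x p) := by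
  have h : ∀ n ∉ p.support,
      ((PowerSeries.coeff n (p : PowerSeries ℚ) : ℚ) : ℝ) * x ^ n = 0 := by
    intro n hn
    simp [notMem_support_iff.1 hn]
  refine ⟨summable_of_ne_finset_zero (s := p.support) fun n hn => by rw [h n hn, norm_zero], ?_⟩
  convert! hasSum_sum_of_ne_finset_zero (L := .unconditional ℕ) h using 1
  rw [aeval_def, eval₂_eq_sum, Polynomial.sum]
  simp

theorem eval₂ (hf : HasAbsSumAt x f y) (p : ℚ[X][X]) :
    HasAbsSumAt x (p.eval₂ coeToPowerSeries.ringHom f)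
      (p.eval₂ (aeval x : ℚ[X] →ₐ[ℚ] ℝ).toRingHom y) := by
  have hpow : ∀ n : ℕ, HasAbsSumAt x (f ^ n) (y ^ n) := by
    intro n
    induction n with
    | zero => simpa using coe_polynomial x 1
    | succ n ih => simpa only [pow_succ] using ih.mul hf
  induction p using Polynomial.induction_on' with
  | add p q hp hq => simpa only [eval₂_add] using hp.add hq
  | monomial n a =>
    rw [eval₂_monomial, eval₂_monomial]
    exact (coe_polynomial x a).mul (hpow n)

end HasAbsSumAt

/-! ### Transcendence criterion by slow growth. -/

/-- If all coefficients vanished at `a`, the nonunit `X - C a` would divide the content. -/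
theorem map_eval_ne_zero_of_isPrimitive {p : ℚ[X][X]} (hp : p.IsPrimitive) (a : ℚ) :
    p.map (evalRingHom a) ≠ 0 := by
  intro h
  refine not_isUnit_X_sub_C a (isPrimitive_iff_isUnit_of_C_dvd.1 hp (X - C a) ?_)
  refine (C_dvd_iff_dvd_coeff _ _).2 fun i => dvd_iff_isRoot.2 ?_
  simpa using congrArg (fun q => q.coeff i) h

/-- A series whose values tend to infinity at points tending to `1`, but slower than every
negative power of the distance to `1`, satisfies no polynomial equation over `ℚ[X]`. -/
theorem eval₂_ne_zero_of_slow_growth {f : PowerSeries ℚ} {x w : ℕ → ℝ}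
    (hx : Tendsto x atTop (𝓝 1)) (hw : Tendsto w atTop atTop)
    (hxw : ∀ d : ℕ, Tendsto (fun k => (x k - 1) * w k ^ d) atTop (𝓝 0))
    (hf : ∀ k, HasAbsSumAt (x k) f (w k)) {p : ℚ[X][X]} (hp : p.IsPrimitive) :
    p.eval₂ coeToPowerSeries.ringHom f ≠ 0 := by
  intro h0
  have hzero : ∀ k, ∑ i ∈ p.support, aeval (x k) (p.coeff i) * w k ^ i = 0 := by
    intro k
    have h := (hf k).eval₂ p
    rw [h0] at h
    have h' := h.unique (by simpa using HasAbsSumAt.coe_polynomial (x k) 0)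
    rwa [eval₂_eq_sum, Polynomial.sum] at h'
  set q : ℝ[X] := p.map ((aeval (1 : ℝ) : ℚ[X] →ₐ[ℚ] ℝ) : ℚ[X] →+* ℝ) with hq
  have hq0 : q ≠ 0 := by
    have h1 : q = (p.map (evalRingHom 1)).map (algebraMap ℚ ℝ) := by
      ext i
      have := aeval_algebraMap_apply ℝ (1 : ℚ) (p.coeff i)
      simpa [hq] using this
    rw [h1, Ne, Polynomial.map_eq_zero_iff (algebraMap ℚ ℝ).injective]
    exact map_eval_ne_zero_of_isPrimitive hp 1
  have hqeval : ∀ y : ℝ, q.eval y = ∑ i ∈ p.support, aeval (1 : ℝ) (p.coeff i) * y ^ i := by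
    intro y
    rw [hq, eval_map, eval₂_eq_sum, Polynomial.sum]
    rfl
  have hlim : Tendsto (fun k => q.eval (w k)) atTop (𝓝 0) := by
    have hterm : ∀ i, Tendsto (fun k => (aeval (1 : ℝ) (p.coeff i) -
        aeval (x k) (p.coeff i)) * w k ^ i) atTop (𝓝 0) := by
      intro i
      -- The factor x - 1 extracted here beats every power of `w`.
      obtain ⟨r, hr⟩ : X - C 1 ∣ p.coeff i - C ((p.coeff i).eval 1) := by
        rw [dvd_iff_isRoot]
        simp
      have hval : ∀ y : ℝ, aeval y (p.coeff i) =
          algebraMap ℚ ℝ ((p.coeff i).eval 1) + (y - 1) * aeval y r := by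
        intro y
        have := congrArg (aeval y) (sub_eq_iff_eq_add'.1 hr)
        simpa using this
      have hr' : Tendsto (fun k => aeval (x k) r) atTop (𝓝 (aeval (1 : ℝ) r)) :=
        (r.continuous_aeval.tendsto 1).comp hx
      have := (hr'.mul (hxw i)).neg
      rw [mul_zero, neg_zero] at this
      refine this.congr fun k => ?_
      rw [hval 1, hval (x k)]
      ring
    have hsum := tendsto_finsetSum p.support fun i _ => hterm i
    rw [Finset.sum_const_zero] at hsum
    refine hsum.congr fun k => ?_
    simp only [sub_mul, Finset.sum_sub_distrib, hzero k, sub_zero, hqeval]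
  rcases lt_or_ge 0 q.degree with hdeg | hdeg
  · exact not_tendsto_nhds_of_tendsto_atTop ((abs_tendsto_atTop q hdeg).comp hw) 0
      (by simpa [Function.comp_def] using hlim.abs)
  · rw [eq_C_of_degree_le_zero hdeg] at hlim hq0
    simp only [eval_C] at hlim
    exact hq0 (by rw [tendsto_nhds_unique tendsto_const_nhds hlim, C_0])

/-! ### Abel means and conclusion. -/

/-- The generating function of `e` with rational coefficients. -/
noncomputable def genEQ : PowerSeries ℚ := PowerSeries.map (Int.castRingHom ℚ) genE

theorem coeff_genEQ (n : ℕ) : ((PowerSeries.coeff n genEQ : ℚ) : ℝ) = e n := by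
  simp [genEQ, PowerSeries.coeff_map, coeff_genE]

theorem hasSum_linear_mul_geometric (a b : ℝ) {x : ℝ} (h0 : 0 ≤ x) (h1 : x < 1) :
    HasSum (fun n : ℕ => (a + b * n) * x ^ n) (a / (1 - x) + b * (x / (1 - x) ^ 2)) := by
  have h2 := (hasSum_geometric_of_lt_one h0 h1).mul_left a
  have h3 := (hasSum_coe_mul_geometric_of_norm_lt_one
    (by rwa [Real.norm_of_nonneg h0] : ‖x‖ < 1)).mul_left b
  rw [div_eq_mul_inv]
  simpa only [add_mul, mul_assoc] using h2.add h3

theorem hasAbsSumAt_genEQ {x : ℝ} (h0 : 0 ≤ x) (h1 : x < 1) :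
    HasAbsSumAt x genEQ (∑' n, (e n : ℝ) * x ^ n) := by
  have hs : Summable fun n => ‖(e n : ℝ) * x ^ n‖ := by
    refine (hasSum_linear_mul_geometric 0 1 h0 h1).summable.of_nonneg_of_le
      (fun _ => norm_nonneg _) fun n => ?_
    rw [Real.norm_of_nonneg (by positivity)]
    gcongr
    simpa using e_le_add_div 0 n
  simp only [HasAbsSumAt, coeff_genEQ]
  exact ⟨hs, hs.of_norm.hasSum⟩

/-- The Abel mean of the sequence `e` at `x`. -/
noncomputable def abelMean (x : ℝ) : ℝ := (1 - x) * ∑' n, (e n : ℝ) * x ^ n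

theorem hasAbsSumAt_one_sub_X_mul_genEQ {x : ℝ} (h0 : 0 ≤ x) (h1 : x < 1) :
    HasAbsSumAt x (((1 - X : ℚ[X]) : PowerSeries ℚ) * genEQ) (abelMean x) := by
  have := (HasAbsSumAt.coe_polynomial x (1 - X)).mul (hasAbsSumAt_genEQ h0 h1)
  rwa [map_sub, map_one, aeval_X] at this

theorem abelMean_le {x : ℝ} (h0 : 0 ≤ x) (h1 : x < 1) (K : ℕ) :
    abelMean x ≤ K + 1 / (2 ^ K * (1 - x)) := by
  have hx : 0 < 1 - x := sub_pos.2 h1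
  have h := (hasSum_linear_mul_geometric K (1 / 2 ^ K) h0 h1)
  have hle : ∑' n, (e n : ℝ) * x ^ n ≤ K / (1 - x) + 1 / 2 ^ K * (x / (1 - x) ^ 2) := by
    rw [← h.tsum_eq]
    have hs := (hasAbsSumAt_genEQ h0 h1).1.of_norm
    simp only [coeff_genEQ] at hs
    refine hs.tsum_le_tsum (fun n => ?_) h.summable
    gcongr
    have := e_le_add_div K n
    rwa [div_eq_inv_mul, inv_eq_one_div] at this
  calc abelMean x ≤ (1 - x) * (K / (1 - x) + 1 / 2 ^ K * (x / (1 - x) ^ 2)) :=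
        mul_le_mul_of_nonneg_left hle hx.le
    _ = K + x / (2 ^ K * (1 - x)) := by field_simp
    _ ≤ K + 1 / (2 ^ K * (1 - x)) := by gcongr

/-- Drop the first `N` terms and compare the tail with a geometric series. -/
theorem le_abelMean {x : ℝ} (h0 : 0 ≤ x) (h1 : x < 1) {m N : ℕ} (hN : ∀ n, N ≤ n → m ≤ e n) :
    m * x ^ N ≤ abelMean x := by
  have hx : 0 < 1 - x := sub_pos.2 h1
  have hs := (hasAbsSumAt_genEQ h0 h1).1.of_norm
  simp only [coeff_genEQ] at hs
  have hg := (hasSum_geometric_of_lt_one h0 h1).mul_left (m * x ^ N)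
  have hle : m * x ^ N * (1 - x)⁻¹ ≤ ∑' n, (e n : ℝ) * x ^ n := by
    rw [← hg.tsum_eq, ← hs.sum_add_tsum_nat_add N]
    refine le_add_of_nonneg_of_le (Finset.sum_nonneg fun _ _ => by positivity)
      (hg.summable.tsum_le_tsum (fun n => ?_) ((summable_nat_add_iff N).2 hs))
    have : (m : ℝ) ≤ e (n + N) := by exact_mod_cast hN _ (Nat.le_add_left N n)
    rw [mul_assoc, ← pow_add, add_comm N]
    gcongr
  calc m * x ^ N = (1 - x) * (m * x ^ N * (1 - x)⁻¹) := by field_simp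
    _ ≤ abelMean x := mul_le_mul_of_nonneg_left hle hx.le

theorem eval₂_one_sub_X_mul_genEQ_ne_zero {p : ℚ[X][X]} (hp : p.IsPrimitive) :
    p.eval₂ coeToPowerSeries.ringHom (((1 - X : ℚ[X]) : PowerSeries ℚ) * genEQ) ≠ 0 := by
  -- With 1 - x = 2⁻ᵏ, taking `K = k` in `abelMean_le` gives the bound k + 1.
  set x : ℕ → ℝ := fun k => 1 - (1 / 2) ^ k with hxdef
  have h0 : ∀ k, 0 ≤ x k := fun k => sub_nonneg.2 (pow_le_one₀ (by norm_num) (by norm_num))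
  have h1 : ∀ k, x k < 1 := fun k => sub_lt_self _ (by positivity)
  have hx : Tendsto x atTop (𝓝 1) := by
    simpa [hxdef] using (tendsto_pow_atTop_nhds_zero_of_lt_one (by norm_num : (0 : ℝ) ≤ 1 / 2)
      (by norm_num)).const_sub 1
  have hnonneg : ∀ k, 0 ≤ abelMean (x k) := by
    intro k
    simpa using le_abelMean (m := 0) (N := 0) (h0 k) (h1 k) fun _ _ => Nat.zero_le _
  have hle : ∀ k, abelMean (x k) ≤ k + 1 := by
    intro k
    have := abelMean_le (h0 k) (h1 k) k
    simpa [hxdef] using this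
  have hw : Tendsto (fun k => abelMean (x k)) atTop atTop := by
    refine tendsto_atTop.2 fun b => ?_
    obtain ⟨m, hm⟩ := exists_nat_gt b
    have hlim : Tendsto (fun k => m * x k ^ 4 ^ m) atTop (𝓝 (m : ℝ)) := by
      simpa using (hx.pow (4 ^ m)).const_mul (m : ℝ)
    filter_upwards [hlim.eventually_const_lt hm] with k hk
    exact hk.le.trans (le_abelMean (h0 k) (h1 k) fun _ => le_e_of_four_pow_le)
  refine eval₂_ne_zero_of_slow_growth hx hw (fun d => ?_)
    (fun k => hasAbsSumAt_one_sub_X_mul_genEQ (h0 k) (h1 k)) hp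
  have hlim := ((tendsto_pow_const_div_const_pow_of_one_lt d (one_lt_two : (1 : ℝ) < 2)).comp
    (tendsto_add_atTop_nat 1)).const_mul 2
  rw [mul_zero] at hlim
  refine squeeze_zero_norm (fun k => ?_) hlim
  have hx' : x k - 1 = -(1 / 2) ^ k := by simp [hxdef]
  rw [norm_mul, hx', norm_neg, Real.norm_of_nonneg (by positivity),
    Real.norm_of_nonneg (pow_nonneg (hnonneg k) d)]
  calc (1 / 2 : ℝ) ^ k * abelMean (x k) ^ d ≤ (1 / 2) ^ k * (k + 1) ^ d := by
        gcongr
        exacts [hnonneg k, hle k]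
    _ = 2 * (((k + 1 : ℕ) : ℝ) ^ d / 2 ^ (k + 1)) := by
        push_cast
        rw [one_div, inv_pow, pow_succ]
        field_simp

theorem transcendental_genEQ :
    Transcendental (RatFunc ℚ) (HahnSeries.ofPowerSeries ℤ ℚ genEQ) := by
  intro halg
  have halg' : IsAlgebraic ℚ[X] (HahnSeries.ofPowerSeries ℤ ℚ genEQ) :=
    (IsFractionRing.isAlgebraic_iff ℚ[X] (RatFunc ℚ) _).2 halg
  -- The factor 1 - X preserves algebraicity and turns the values of the series into Abel means.
  obtain ⟨p, hp0, hp⟩ := (isAlgebraic_algebraMap (1 - X : ℚ[X])).mul halg'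
  set f := ((1 - X : ℚ[X]) : PowerSeries ℚ) * genEQ with hf
  have h0 : p.eval₂ coeToPowerSeries.ringHom f = 0 := by
    refine HahnSeries.ofPowerSeries_injective (Γ := ℤ) ?_
    rw [map_zero, hom_eval₂, hf, map_mul]
    exact hp
  -- Dividing out the content makes the relation primitive.
  rw [p.eq_C_content_mul_primPart, eval₂_mul, eval₂_C, mul_eq_zero] at h0
  refine h0.elim (fun h => hp0 (content_eq_zero_iff.1 (coe_injective ℚ ?_)))
    (eval₂_one_sub_X_mul_genEQ_ne_zero p.isPrimitive_primPart)
  rw [coe_zero]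
  exact h

end SternDegree

theorem mainTheorem6 :
    SternDegree.IsKRegular 2 SternDegree.genE ∧
    SternDegree.IsKRegular 2 (PowerSeries.map (Int.castRingHom ℚ) SternDegree.genE) ∧
    Transcendental (RatFunc ℚ)
      (HahnSeries.ofPowerSeries ℤ ℚ (PowerSeries.map (Int.castRingHom ℚ) SternDegree.genE)) := by
  refine ⟨?_, SternDegree.isKRegular_map_genE _, SternDegree.transcendental_genEQ⟩
  simpa using SternDegree.isKRegular_map_genE (RingHom.id ℤ)
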